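/- Let $H$ be a separable complex Hilbert space and let $\mathcal M$ be a von Neumann algebra of bounded operators on $H$. A projection-valued measure $E$ on $X\in\{\mathbb R,\mathbb C\}$ assigns to each Borel set $\Delta\subseteq X$ an orthogonal projection $E(\Delta)$ on $H$, with $E(X)=I$ and $E(\bigcup_n\Delta_n)=\sum_n E(\Delta_n)$ (weak convergence) for pairwise disjoint Borel sets $\Delta_1,\Delta_2,\dots$. It is a spectral measure of a normal operator $N$ if $X=\mathbb C$ and $N=\int_{\mathbb C}\zeta\,dE_\zeta$, and of a self-adjoint operator $A$ if $X=\mathbb R$ and $A=\int_{\mathbb R}\lambda\,dE_\lambda$; the projections $E(\Delta)$ are then called the spectral projections of the operator, and the family $\{E(\Delta):\Delta\subseteq X\text{ Borel}\}$ its spectral decomposition. Let $\mathcal P_{\mathcal N}$ be the set of all spectral projections of all normal operators in $\mathcal M$, and $\mathcal P_{\mathcal S}$ the set of all spectral projections of all self-adjoint operators in $\mathcal M$. Then: 1. $\mathcal P_{\mathcal N}=\mathcal P_{\mathcal S}$. 2. This common set is a lattice of projections: it contains $0$ and $I$, and with $P$ and $Q$ it contains the projection $P\wedge Q$ onto $\operatorname{ran}P\cap\operatorname{ran}Q$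 and the projection $P\vee Q$ onto the closed linear span of $\operatorname{ran}P\cup\operatorname{ran}Q$. 3. The normal and the self-adjoint operators in $\mathcal M$ have the same spectral decompositions: a family of projections is the spectral decomposition of some normal operator in $\mathcal M$ if and only if it is the spectral decomposition of some self-adjoint operator in $\mathcal M$. -/

import Mathlib

open MeasureTheory

/-- A projection-valued measure on a measurable space `X`, acting on a complex Hilbert space `H`:
every measurable set is sent to an orthogonal projection, the whole space to the identity, and a
countable disjoint union to the weakly convergent sum of the projections. The value on
non-measurable sets is irrelevant. -/
structure ProjectionValuedMeasure (X : Type*) [MeasurableSpace X] (H : Type*)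
    [NormedAddCommGroup H] [InnerProductSpace ℂ H] [CompleteSpace H] where
  /-- The projection attached to a set. -/
  proj : Set X → (H →L[ℂ] H)
  isStarProjection : ∀ s : Set X, MeasurableSet s → IsStarProjection (proj s)
  proj_univ : proj Set.univ = 1
  hasSum_iUnion : ∀ s : ℕ → Set X, (∀ n, MeasurableSet (s n)) →
    Pairwise (Function.onFun Disjoint s) →
    ∀ φ ψ : H, HasSum (fun n => inner ℂ φ (proj (s n) ψ)) (inner ℂ φ (proj (⋃ n, s n) ψ))

namespace ProjectionValuedMeasure

variable {X : Type*} [MeasurableSpace X] {H : Type*}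
  [NormedAddCommGroup H] [InnerProductSpace ℂ H] [CompleteSpace H]

theorem proj_empty (E : ProjectionValuedMeasure X H) : E.proj ∅ = 0 := by
  ext ψ
  refine ext_inner_left ℂ fun φ => ?_
  have h := E.hasSum_iUnion (fun _ => ∅) (fun _ => MeasurableSet.empty)
    (fun _ _ _ => disjoint_bot_left) φ ψ
  have h0 := tendsto_nhds_unique h.summable.tendsto_atTop_zero tendsto_const_nhds
  simpa using h0.symm

theorem re_inner_nonneg (E : ProjectionValuedMeasure X H) {s : Set X} (hs : MeasurableSet s)
    (ψ : H) : 0 ≤ (inner ℂ ψ (E.proj s ψ)).re := by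
  have hp := E.isStarProjection s hs
  have h1 : E.proj s ψ = E.proj s (E.proj s ψ) := by
    conv_lhs => rw [← hp.isIdempotentElem.eq]
    rfl
  have h2 : inner ℂ ψ (E.proj s (E.proj s ψ)) = inner ℂ (E.proj s ψ) (E.proj s ψ) := by
    rw [← ContinuousLinearMap.adjoint_inner_left, ← ContinuousLinearMap.star_eq_adjoint,
      hp.isSelfAdjoint.star_eq]
  rw [h1, h2]
  exact inner_self_nonneg (𝕜 := ℂ)

/-- The scalar measure `Δ ↦ ⟪ψ, E(Δ) ψ⟫` attached to a vector `ψ`. -/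
noncomputable def vectorMeasure (E : ProjectionValuedMeasure X H) (ψ : H) : Measure X :=
  Measure.ofMeasurable (fun s _ => ENNReal.ofReal (inner ℂ ψ (E.proj s ψ)).re)
    (by simp [E.proj_empty])
    (by
      intro s hs hd
      have h := Complex.hasSum_re (E.hasSum_iUnion s hs hd ψ ψ)
      rw [← h.tsum_eq, ENNReal.ofReal_tsum_of_nonneg (fun n => E.re_inner_nonneg (hs n) ψ)
        h.summable])

theorem vectorMeasure_apply (E : ProjectionValuedMeasure X H) (ψ : H) {s : Set X}
    (hs : MeasurableSet s) :
    E.vectorMeasure ψ s = ENNReal.ofReal (inner ℂ ψ (E.proj s ψ)).re :=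
  Measure.ofMeasurable_apply s hs

/-- `A = ∫ f dE`, in the weak sense, for a bounded operator `A`: for every vector `ψ` the function
`f` is integrable for the measure `⟪ψ, E(·) ψ⟫` and its integral is `⟪ψ, A ψ⟫`. By polarization
the numbers `⟪ψ, A ψ⟫` determine `A`. -/
def IsIntegral (E : ProjectionValuedMeasure X H) (f : X → ℂ) (A : H →L[ℂ] H) : Prop :=
  ∀ ψ : H, Integrable f (E.vectorMeasure ψ) ∧
    inner ℂ ψ (A ψ) = ∫ x, f x ∂(E.vectorMeasure ψ)

/-- The family of all projections `E(Δ)`, `Δ` measurable. -/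
def projections (E : ProjectionValuedMeasure X H) : Set (H →L[ℂ] H) :=
  {P | ∃ s : Set X, MeasurableSet s ∧ E.proj s = P}

end ProjectionValuedMeasure

namespace VonNeumannAlgebra

variable {H : Type*} [NormedAddCommGroup H] [InnerProductSpace ℂ H] [CompleteSpace H]

/-- The spectral decompositions of the normal operators of `M`: the families `{E(Δ)}`, `Δ ⊆ ℂ`
Borel, where `E` is a projection-valued measure on `ℂ` with `N = ∫ ζ dE(ζ)`, `N ∈ M` normal. -/
def normalDecompositions (M : VonNeumannAlgebra H) : Set (Set (H →L[ℂ] H)) :=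
  {𝓑 | ∃ N ∈ M, IsStarNormal N ∧ ∃ E : ProjectionValuedMeasure ℂ H,
    E.IsIntegral (fun ζ => ζ) N ∧ E.projections = 𝓑}

/-- The spectral decompositions of the self-adjoint operators of `M`: the families `{E(Δ)}`,
`Δ ⊆ ℝ` Borel, where `E` is a projection-valued measure on `ℝ` with `A = ∫ t dE(t)`,
`A ∈ M` self-adjoint. -/
def selfAdjointDecompositions (M : VonNeumannAlgebra H) : Set (Set (H →L[ℂ] H)) :=
  {𝓑 | ∃ A ∈ M, IsSelfAdjoint A ∧ ∃ E : ProjectionValuedMeasure ℝ H,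
    E.IsIntegral (fun t => (t : ℂ)) A ∧ E.projections = 𝓑}

/-- All spectral projections of normal operators of `M`. -/
def normalProjections (M : VonNeumannAlgebra H) : Set (H →L[ℂ] H) :=
  ⋃₀ M.normalDecompositions

/-- All spectral projections of self-adjoint operators of `M`. -/
def selfAdjointProjections (M : VonNeumannAlgebra H) : Set (H →L[ℂ] H) :=
  ⋃₀ M.selfAdjointDecompositions

end VonNeumannAlgebra

/-- `𝓟` is a (bounded) lattice of orthogonal projections on `H`: it contains `0` and `1`, and with
`P` and `Q` it contains the projection onto `ran P ∩ ran Q` (their meet) and the projection onto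
the closed span of `ran P` and `ran Q` (their join). -/
structure IsProjectionLattice {H : Type*} [NormedAddCommGroup H] [InnerProductSpace ℂ H]
    [CompleteSpace H] (𝓟 : Set (H →L[ℂ] H)) : Prop where
  isStarProjection : ∀ P ∈ 𝓟, IsStarProjection P
  zero_mem : 0 ∈ 𝓟
  one_mem : 1 ∈ 𝓟
  exists_inf : ∀ P ∈ 𝓟, ∀ Q ∈ 𝓟, ∃ R ∈ 𝓟, R.range = P.range ⊓ Q.range
  exists_sup : ∀ P ∈ 𝓟, ∀ Q ∈ 𝓟, ∃ R ∈ 𝓟, R.range = (P.range ⊔ Q.range).topologicalClosure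

/-! A spectral measure `E` of a normal `N ∈ M` takes its values in `M`
(`proj_mem_of_isIntegral_id`): for a real part with symbol `f`, the range of `E {f ≤ 0}` is the
kernel of the positive part, which the commutant leaves invariant; shifts, generation from
half-lines and products then reach every Borel set. A Borel embedding `g : ℂ → ℝ`, chosen so that `∫
g dE` is a norm-convergent series in `M`, carries `E` to the line without changing the family of
projections; the inclusion of `ℝ` in `ℂ` goes back. This gives equality of the decompositions, hence
of their unions. Each projection of `M` is a spectral projection of itself, so the common set is all
projections of `M`; these form a lattice because membership in `M` means that the range is invariant
under the commutant. -/

namespace ProjectionValuedMeasure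

variable {X : Type*} [MeasurableSpace X] {H : Type*}
  [NormedAddCommGroup H] [InnerProductSpace ℂ H] [CompleteSpace H]

/-! ### Algebra of a projection-valued measure -/

theorem inner_proj_self (E : ProjectionValuedMeasure X H) {s : Set X} (hs : MeasurableSet s)
    (ψ : H) : inner ℂ ψ (E.proj s ψ) = ((E.vectorMeasure ψ).real s : ℂ) := by
  have hre := E.re_inner_nonneg hs ψ
  rw [Measure.real, E.vectorMeasure_apply ψ hs, ENNReal.toReal_ofReal hre]
  refine Complex.ext rfl ?_
  have h := (E.isStarProjection s hs).isSelfAdjoint.isSymmetric.im_inner_apply_self ψ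
  rw [← inner_conj_symm, Complex.conj_im]
  simpa using h

instance (E : ProjectionValuedMeasure X H) (ψ : H) : IsFiniteMeasure (E.vectorMeasure ψ) :=
  ⟨by rw [E.vectorMeasure_apply ψ .univ]; exact ENNReal.ofReal_lt_top⟩

omit [CompleteSpace H] in
theorem ext_inner_self {A B : H →L[ℂ] H}
    (h : ∀ ψ : H, inner ℂ ψ (A ψ) = inner ℂ ψ (B ψ)) : A = B := by
  have := (ext_inner_map (A : H →ₗ[ℂ] H) (B : H →ₗ[ℂ] H)).1 fun x => by
    rw [← inner_conj_symm, ← inner_conj_symm (𝕜 := ℂ) ((B : H →ₗ[ℂ] H) x)]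
    exact congrArg _ (h x)
  exact ContinuousLinearMap.coe_injective this

theorem proj_union (E : ProjectionValuedMeasure X H) {s t : Set X} (hs : MeasurableSet s)
    (ht : MeasurableSet t) (hd : Disjoint s t) : E.proj (s ∪ t) = E.proj s + E.proj t := by
  refine ext_inner_self fun ψ => ?_
  rw [add_apply, inner_add_right, E.inner_proj_self (hs.union ht),
    E.inner_proj_self hs, E.inner_proj_self ht, measureReal_union hd ht]
  push_cast
  rfl

/-- With `P` and `Q` the two projections, idempotence of `P + Q` gives `PQ + QP = 0`. Multiplying by
`P` on either side yields `PQ = -PQP = QP`, so `2PQ = 0`. -/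
theorem proj_mul_of_disjoint (E : ProjectionValuedMeasure X H) {s t : Set X}
    (hs : MeasurableSet s) (ht : MeasurableSet t) (hd : Disjoint s t) :
    E.proj s * E.proj t = 0 := by
  have hu := (E.isStarProjection _ (hs.union ht)).isIdempotentElem.eq
  have ps := (E.isStarProjection s hs).isIdempotentElem
  have pt := (E.isStarProjection t ht).isIdempotentElem
  rw [E.proj_union hs ht hd, add_mul, mul_add, mul_add, ps.eq, pt.eq] at hu
  have h0 : E.proj s * E.proj t + E.proj t * E.proj s = 0 := by
    rw [← sub_eq_zero] at hu
    rw [← hu]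
    abel
  have hl : E.proj s * E.proj t + E.proj s * E.proj t * E.proj s = 0 := by
    simpa [mul_add, ← mul_assoc, ps.eq] using congrArg (E.proj s * ·) h0
  have hr : E.proj s * E.proj t * E.proj s + E.proj t * E.proj s = 0 := by
    simpa [add_mul, mul_assoc, ps.eq] using congrArg (· * E.proj s) h0
  rw [add_comm] at hr
  rw [← add_right_cancel (hl.trans hr.symm), ← two_smul ℂ] at h0
  simpa using h0

theorem proj_inter (E : ProjectionValuedMeasure X H) {s t : Set X}
    (hs : MeasurableSet s) (ht : MeasurableSet t) :
    E.proj (s ∩ t) = E.proj s * E.proj t := by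
  have h1 : E.proj s = E.proj (s ∩ t) + E.proj (s \ t) := by
    rw [← E.proj_union (hs.inter ht) (hs.diff ht)
      (Set.disjoint_sdiff_right.mono_left Set.inter_subset_right), Set.inter_union_sdiff]
  have h2 : E.proj t = E.proj (s ∩ t) + E.proj (t \ s) := by
    rw [← E.proj_union (hs.inter ht) (ht.diff hs)
      (Set.disjoint_sdiff_right.mono_left Set.inter_subset_left), Set.inter_comm,
      Set.inter_union_sdiff]
  have h3 : E.proj (s \ t) * E.proj t = 0 :=
    E.proj_mul_of_disjoint (hs.diff ht) ht Set.disjoint_sdiff_left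
  have h4 : E.proj (s ∩ t) * E.proj (t \ s) = 0 :=
    E.proj_mul_of_disjoint (hs.inter ht) (ht.diff hs)
      (Set.disjoint_sdiff_right.mono_left Set.inter_subset_left)
  rw [h1, add_mul, h3, h2, mul_add, h4, add_zero, add_zero,
    (E.isStarProjection _ (hs.inter ht)).isIdempotentElem.eq]

theorem proj_compl (E : ProjectionValuedMeasure X H) {s : Set X} (hs : MeasurableSet s) :
    E.proj sᶜ = 1 - E.proj s := by
  rw [← E.proj_univ, ← Set.union_compl_self s, E.proj_union hs hs.compl disjoint_compl_right]
  abel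

theorem inner_proj_left (E : ProjectionValuedMeasure X H) {s : Set X} (hs : MeasurableSet s)
    (φ ψ : H) : inner ℂ (E.proj s φ) ψ = inner ℂ φ (E.proj s ψ) :=
  (E.isStarProjection s hs).isSelfAdjoint.isSymmetric φ ψ

theorem vectorMeasure_proj (E : ProjectionValuedMeasure X H) {s : Set X} (hs : MeasurableSet s)
    (ψ : H) : E.vectorMeasure (E.proj s ψ) = (E.vectorMeasure ψ).restrict s := by
  ext t ht
  have h : E.proj (t ∩ s) = E.proj s * (E.proj t * E.proj s) := by
    rw [← E.proj_inter ht hs, ← E.proj_inter hs (ht.inter hs),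
      Set.inter_eq_right.2 Set.inter_subset_right]
  rw [Measure.restrict_apply ht, E.vectorMeasure_apply _ ht, E.vectorMeasure_apply _ (ht.inter hs),
    E.inner_proj_left hs, h]
  rfl

theorem proj_eq_zero_of_vectorMeasure (E : ProjectionValuedMeasure X H) {s : Set X}
    (hs : MeasurableSet s) {ψ : H} (h : E.vectorMeasure ψ s = 0) : E.proj s ψ = 0 := by
  rw [← inner_self_eq_zero (𝕜 := ℂ), E.inner_proj_left hs,
    show E.proj s (E.proj s ψ) = E.proj s ψ from
      DFunLike.congr_fun (E.isStarProjection s hs).isIdempotentElem.eq ψ,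
    E.inner_proj_self hs, Measure.real, h]
  simp

/-! ### Calculus of weak integrals -/

namespace IsIntegral

variable {E : ProjectionValuedMeasure X H} {f g : X → ℂ} {A B : H →L[ℂ] H}

theorem unique (hA : E.IsIntegral f A) (hB : E.IsIntegral f B) : A = B :=
  ext_inner_self fun ψ => (hA ψ).2.trans (hB ψ).2.symm

theorem add (hA : E.IsIntegral f A) (hB : E.IsIntegral g B) :
    E.IsIntegral (fun x => f x + g x) (A + B) := fun ψ =>
  ⟨(hA ψ).1.add (hB ψ).1, by
    rw [integral_add (hA ψ).1 (hB ψ).1, ← (hA ψ).2, ← (hB ψ).2, add_apply,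
      inner_add_right]⟩

theorem smul (c : ℂ) (hA : E.IsIntegral f A) : E.IsIntegral (fun x => c * f x) (c • A) := fun ψ =>
  ⟨(hA ψ).1.const_mul c, by
    rw [integral_const_mul, ← (hA ψ).2, smul_apply, inner_smul_right]⟩

theorem star (hA : E.IsIntegral f A) :
    E.IsIntegral (fun x => starRingEnd ℂ (f x)) (star A) := fun ψ =>
  ⟨(LipschitzWith.integrable_comp_iff_of_antilipschitz
      Complex.isometry_conj.lipschitz Complex.isometry_conj.antilipschitz (map_zero _)).2 (hA ψ).1, by
    rw [integral_conj, ← (hA ψ).2, ContinuousLinearMap.star_eq_adjoint,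
      ContinuousLinearMap.adjoint_inner_right, inner_conj_symm]⟩

theorem proj (E : ProjectionValuedMeasure X H) {s : Set X} (hs : MeasurableSet s) :
    E.IsIntegral (s.indicator fun _ => 1) (E.proj s) := fun ψ =>
  ⟨(integrable_const _).indicator hs, by
    rw [integral_indicator_const _ hs, E.inner_proj_self hs]
    simp⟩

theorem one (E : ProjectionValuedMeasure X H) : E.IsIntegral (fun _ => 1) 1 := by
  simpa [E.proj_univ] using proj E .univ

theorem compress (hA : E.IsIntegral f A) {s : Set X} (hs : MeasurableSet s) :
    E.IsIntegral (s.indicator f) (E.proj s * A * E.proj s) := fun ψ => by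
  refine ⟨(hA ψ).1.indicator hs, ?_⟩
  rw [integral_indicator hs, ← E.vectorMeasure_proj hs, ← (hA _).2, E.inner_proj_left hs]
  rfl

/-- Compressing to `s` and to `sᶜ` integrates the two halves of `f`, so by uniqueness `A` is the sum
of its compressions: it is block diagonal. -/
theorem commute (hA : E.IsIntegral f A) {s : Set X} (hs : MeasurableSet s) :
    Commute (E.proj s) A := by
  have h : A = E.proj s * A * E.proj s + E.proj sᶜ * A * E.proj sᶜ := by
    refine hA.unique ?_
    convert (hA.compress hs).add (hA.compress hs.compl) using 2 with x
    by_cases hx : x ∈ s <;> simp [hx]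
  have h0 : E.proj s * E.proj sᶜ = 0 := E.proj_mul_of_disjoint hs hs.compl disjoint_compl_right
  have h1 : E.proj sᶜ * E.proj s = 0 := E.proj_mul_of_disjoint hs.compl hs disjoint_compl_left
  have hp := (E.isStarProjection s hs).isIdempotentElem.eq
  have e1 : E.proj s * A = E.proj s * A * E.proj s := by
    conv_lhs => rw [h]
    simp only [mul_add, ← mul_assoc, hp, h0, zero_mul, add_zero]
  have e2 : A * E.proj s = E.proj s * A * E.proj s := by
    conv_lhs => rw [h]
    simp only [add_mul, mul_assoc, hp, h1, mul_zero, add_zero]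
  exact e1.trans e2.symm

theorem proj_mul (hA : E.IsIntegral f A) {s : Set X} (hs : MeasurableSet s) :
    E.IsIntegral (s.indicator f) (E.proj s * A) := by
  have h := hA.compress hs
  rwa [mul_assoc, ← (hA.commute hs).eq, ← mul_assoc,
    (E.isStarProjection s hs).isIdempotentElem.eq] at h

theorem isSelfAdjoint {f : X → ℝ} (hA : E.IsIntegral (fun x => (f x : ℂ)) A) :
    IsSelfAdjoint A :=
  IsIntegral.unique (f := fun x => (f x : ℂ)) (by simpa using hA.star) hA

theorem nonneg {f : X → ℝ} (hA : E.IsIntegral (fun x => (f x : ℂ)) A) (hf : 0 ≤ f) :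
    0 ≤ A := by
  rw [ContinuousLinearMap.nonneg_iff_isPositive, ContinuousLinearMap.isPositive_iff_complex]
  intro ψ
  have h := (hA ψ).2
  rw [integral_complex_ofReal] at h
  rw [← inner_conj_symm, h]
  simpa using integral_nonneg hf

theorem realPart (hA : E.IsIntegral f A) :
    E.IsIntegral (fun x => ((f x).re : ℂ)) (_root_.realPart A : H →L[ℂ] H) := by
  have h := (hA.add hA.star).smul (2⁻¹ : ℂ)
  rw [realPart_apply_coe]
  convert h using 2 with x
  · rw [Complex.re_eq_add_conj]; ring
  · ext
    simp [← Complex.coe_smul]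

theorem imaginaryPart (hA : E.IsIntegral f A) :
    E.IsIntegral (fun x => ((f x).im : ℂ)) (_root_.imaginaryPart A : H →L[ℂ] H) := by
  have h := (hA.smul (-Complex.I)).realPart
  rw [show _root_.imaginaryPart A = _root_.realPart (-Complex.I • A) by
    rw [neg_smul, map_neg, realPart_I_smul, neg_neg]]
  simpa using h

end IsIntegral

/-! ### Spectral projections belong to the algebra -/

theorem proj_nonpos_mem (E : ProjectionValuedMeasure X H) (M : VonNeumannAlgebra H)
    {A : H →L[ℂ] H} {f : X → ℝ} (hf : Measurable f)
    (hA : E.IsIntegral (fun x => (f x : ℂ)) A) (hM : A ∈ M) :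
    E.proj {x | f x ≤ 0} ∈ M := by
  set s : Set X := {x | f x ≤ 0} with hsdef
  have hs : MeasurableSet s := measurableSet_le hf measurable_const
  have hpos : E.IsIntegral (fun x => ((sᶜ.indicator f x : ℝ) : ℂ)) (E.proj sᶜ * A) := by
    convert hA.proj_mul hs.compl using 2 with x
    by_cases hx : x ∈ s <;> simp [hx]
  have hneg : E.IsIntegral (fun x => ((-s.indicator f x : ℝ) : ℂ)) (-(E.proj s * A)) := by
    convert (hA.proj_mul hs).smul (-1) using 2 with x
    · by_cases hx : x ∈ s <;> simp [hx]
    · simp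
  have h0 : 0 ≤ sᶜ.indicator f := Set.indicator_nonneg fun x (hx : ¬ f x ≤ 0) => (not_le.1 hx).le
  have hB := hpos.nonneg h0
  have hC := hneg.nonneg fun x => neg_nonneg.2 (Set.indicator_nonpos (fun x hx => hx) x)
  -- Two positive operators with product zero and difference `A` must be `A⁺` and `A⁻`.
  have hparts := CFC.posPart_negPart_unique (a := A) (b := E.proj sᶜ * A) (c := -(E.proj s * A))
    (by rw [sub_neg_eq_add, ← add_mul, E.proj_compl hs, sub_add_cancel, one_mul])
    (by
      rw [mul_neg, (hA.commute hs.compl).eq, mul_assoc A, ← mul_assoc (E.proj sᶜ),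
        E.proj_mul_of_disjoint hs.compl hs disjoint_compl_left, zero_mul, mul_zero, neg_zero]) hB hC
  have hker : (E.proj s : H →L[ℂ] H).range = (A⁺).ker := by
    ext ψ
    rw [hparts.1]
    constructor
    · rintro ⟨φ, rfl⟩
      have h1 : E.proj sᶜ * A * E.proj s = 0 := by
        rw [mul_assoc, ← (hA.commute hs).eq, ← mul_assoc,
          E.proj_mul_of_disjoint hs.compl hs disjoint_compl_left, zero_mul]
      exact DFunLike.congr_fun h1 φ
    · intro hψ
      -- The integral of a function strictly positive on `sᶜ` vanishes, so `sᶜ` is null for `ψ`.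
      have h1 := (hpos ψ).2
      rw [show (E.proj sᶜ * A) ψ = 0 from hψ, inner_zero_right, integral_complex_ofReal] at h1
      have h2 : Integrable (sᶜ.indicator f) (E.vectorMeasure ψ) := by
        simpa using (hpos ψ).1.re
      have h3 := (integral_eq_zero_iff_of_nonneg h0 h2).1 (by exact_mod_cast h1.symm)
      have h4 : E.vectorMeasure ψ sᶜ = 0 := by
        refine measure_mono_null (fun x hx => ?_) h3
        simp only [Set.mem_compl_iff, Set.mem_ofPred_eq]
        intro h
        rw [Set.indicator_of_mem hx] at h
        exact hx h.le
      have h5 := E.proj_eq_zero_of_vectorMeasure hs.compl h4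
      rw [E.proj_compl hs] at h5
      exact ⟨ψ, (sub_eq_zero.1 h5).symm⟩
  rw [VonNeumannAlgebra.IsStarProjection.mem_iff (E.isStarProjection s hs)]
  intro y hy
  have hcomm : Commute A⁺ y :=
    Commute.cfcₙ_real (VonNeumannAlgebra.mem_commutant_iff.1 hy A hM) _
  rw [hker, Module.End.mem_invtSubmodule]
  intro ψ hψ
  have h : A⁺ (y ψ) = y (A⁺ ψ) := DFunLike.congr_fun hcomm.eq ψ
  change A⁺ (y ψ) = 0
  rw [h, show A⁺ ψ = 0 from hψ, map_zero]

/-- A Dynkin argument. Weak convergence suffices for countable unions, since commuting with a fixed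
operator passes to weak limits. -/
theorem proj_mem_of_generateFrom (E : ProjectionValuedMeasure X H) (M : VonNeumannAlgebra H)
    {C : Set (Set X)} (hgen : ‹MeasurableSpace X› = MeasurableSpace.generateFrom C)
    (hC : IsPiSystem C) (h : ∀ s ∈ C, E.proj s ∈ M) {s : Set X} (hs : MeasurableSet s) :
    E.proj s ∈ M := by
  induction s, hs using MeasurableSpace.induction_on_inter hgen hC with
  | empty => rw [E.proj_empty]; exact zero_mem M
  | basic t ht => exact h t ht
  | compl t ht ih => rw [E.proj_compl ht]; exact sub_mem (one_mem M) ih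
  | iUnion t hd ht ih =>
    rw [← VonNeumannAlgebra.commutant_commutant M, VonNeumannAlgebra.mem_commutant_iff]
    intro y hy
    ext ψ
    refine ext_inner_left ℂ fun φ => ?_
    have h1 := E.hasSum_iUnion t ht hd (ContinuousLinearMap.adjoint y φ) ψ
    have h2 := E.hasSum_iUnion t ht hd φ (y ψ)
    simp only [ContinuousLinearMap.adjoint_inner_left] at h1
    have h3 : (fun n => inner ℂ φ (y (E.proj (t n) ψ))) =
        fun n => inner ℂ φ (E.proj (t n) (y ψ)) :=
      funext fun n => congrArg (inner ℂ φ)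
        (DFunLike.congr_fun (VonNeumannAlgebra.mem_commutant_iff.1 hy _ (ih n)).symm ψ)
    rw [h3] at h1
    exact h1.unique h2

end ProjectionValuedMeasure

theorem VonNeumannAlgebra.smul_mem {H : Type*} [NormedAddCommGroup H] [InnerProductSpace ℂ H]
    [CompleteSpace H] (M : VonNeumannAlgebra H) (c : ℂ) {A : H →L[ℂ] H} (hA : A ∈ M) :
    c • A ∈ M :=
  M.toStarSubalgebra.smul_mem hA c

/-! ### Images under measurable maps -/

namespace ProjectionValuedMeasure

variable {X Y : Type*} [MeasurableSpace X] [MeasurableSpace Y] {H : Type*}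
  [NormedAddCommGroup H] [InnerProductSpace ℂ H] [CompleteSpace H]

/-- The image of a projection-valued measure under a measurable map. -/
def map (E : ProjectionValuedMeasure X H) (g : X → Y) (hg : Measurable g) :
    ProjectionValuedMeasure Y H where
  proj s := E.proj (g ⁻¹' s)
  isStarProjection s hs := E.isStarProjection _ (hg hs)
  proj_univ := E.proj_univ
  hasSum_iUnion s hs hd φ ψ := by
    rw [Set.preimage_iUnion]
    exact E.hasSum_iUnion _ (fun n => hg (hs n)) (fun i j hij => (hd hij).preimage g) φ ψ

theorem vectorMeasure_map (E : ProjectionValuedMeasure X H) {g : X → Y} (hg : Measurable g)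
    (ψ : H) : (E.map g hg).vectorMeasure ψ = (E.vectorMeasure ψ).map g := by
  ext s hs
  rw [Measure.map_apply hg hs, vectorMeasure_apply _ _ hs, vectorMeasure_apply _ _ (hg hs)]
  rfl

theorem isIntegral_map_iff (E : ProjectionValuedMeasure X H) {g : X → Y} (hg : Measurable g)
    {f : Y → ℂ} (hf : Measurable f) {A : H →L[ℂ] H} :
    (E.map g hg).IsIntegral f A ↔ E.IsIntegral (fun x => f (g x)) A := by
  refine forall_congr' fun ψ => ?_
  rw [E.vectorMeasure_map hg, integrable_map_measure hf.aestronglyMeasurable hg.aemeasurable,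
    integral_map hg.aemeasurable hf.aestronglyMeasurable]
  rfl

theorem projections_map (E : ProjectionValuedMeasure X H) {g : X → Y}
    (hg : MeasurableEmbedding g) : (E.map g hg.measurable).projections = E.projections := by
  ext P
  constructor
  · rintro ⟨s, hs, rfl⟩
    exact ⟨g ⁻¹' s, hg.measurable hs, rfl⟩
  · rintro ⟨s, hs, rfl⟩
    exact ⟨g '' s, hg.measurableSet_image.2 hs, congrArg E.proj (hg.injective.preimage_image s)⟩

theorem proj_preimage_mem (E : ProjectionValuedMeasure X H) (M : VonNeumannAlgebra H)
    {A : H →L[ℂ] H} {f : X → ℝ} (hf : Measurable f)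
    (hA : E.IsIntegral (fun x => (f x : ℂ)) A) (hM : A ∈ M) {s : Set ℝ} (hs : MeasurableSet s) :
    E.proj (f ⁻¹' s) ∈ M := by
  refine (E.map f hf).proj_mem_of_generateFrom M
    ((BorelSpace.measurable_eq (α := ℝ)).trans (borel_eq_generateFrom_Iic ℝ)) isPiSystem_Iic ?_ hs
  rintro _ ⟨b, rfl⟩
  -- Shifting by `b` turns `{f ≤ b}` into a set treated by `proj_nonpos_mem`.
  have hb : E.IsIntegral (fun x => ((f x - b : ℝ) : ℂ)) (A + (-b : ℂ) • 1) := by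
    convert hA.add ((IsIntegral.one E).smul (-b : ℂ)) using 2 with x
    push_cast
    ring
  have h := E.proj_nonpos_mem M (hf.sub_const b) hb
    (add_mem hM (M.smul_mem _ (one_mem M)))
  simp only [sub_nonpos] at h
  exact h

theorem proj_mem_of_isIntegral_id (E : ProjectionValuedMeasure ℂ H) (M : VonNeumannAlgebra H)
    {N : H →L[ℂ] H} (hN : E.IsIntegral (fun z => z) N) (hM : N ∈ M) {s : Set ℂ}
    (hs : MeasurableSet s) : E.proj s ∈ M := by
  let e := Complex.measurableEquivRealProd
  have key : ∀ t : Set (ℝ × ℝ), MeasurableSet t → (E.map e e.measurable).proj t ∈ M := by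
    intro t ht
    refine (E.map e e.measurable).proj_mem_of_generateFrom M generateFrom_prod.symm
      isPiSystem_prod ?_ ht
    -- The projection of a rectangle is a product of one for the real part and one for the imaginary
    -- part.
    rintro _ ⟨u, hu, v, hv, rfl⟩
    have hstar : star N ∈ M := star_mem hM
    have hre : (realPart N : H →L[ℂ] H) ∈ M := by
      rw [realPart_apply_coe, ← Complex.coe_smul]
      exact M.smul_mem _ (add_mem hM hstar)
    have him : (imaginaryPart N : H →L[ℂ] H) ∈ M := by
      rw [imaginaryPart_apply_coe, ← Complex.coe_smul]
      exact M.smul_mem _ (M.smul_mem _ (sub_mem hM hstar))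
    have h := mul_mem (E.proj_preimage_mem M Complex.measurable_re hN.realPart hre hu)
      (E.proj_preimage_mem M Complex.measurable_im hN.imaginaryPart him hv)
    rwa [← E.proj_inter (Complex.measurable_re hu) (Complex.measurable_im hv)] at h
  have h := key (e.symm ⁻¹' s) (e.symm.measurable hs)
  change E.proj (e ⁻¹' (e.symm ⁻¹' s)) ∈ M at h
  rwa [← Set.preimage_comp, e.symm_comp_self, Set.preimage_id] at h

/-! ### Coding a standard Borel space in the line -/

theorem IsIntegral.hasSum {E : ProjectionValuedMeasure X H} {f : ℕ → X → ℂ}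
    {A : ℕ → H →L[ℂ] H} {c : ℕ → ℝ} (hA : ∀ n, E.IsIntegral (f n) (A n)) (hc : Summable c)
    (hf : ∀ n x, ‖f n x‖ ≤ c n) {B : H →L[ℂ] H} (hB : HasSum A B) :
    E.IsIntegral (fun x => ∑' n, f n x) B := fun ψ => by
  have hsum : Summable fun n => ∫ x, ‖f n x‖ ∂E.vectorMeasure ψ := by
    refine Summable.of_nonneg_of_le (fun n => integral_nonneg fun x => norm_nonneg _)
      (fun n => ?_) (hc.mul_left ((E.vectorMeasure ψ).real Set.univ))
    calc ∫ x, ‖f n x‖ ∂E.vectorMeasure ψ ≤ ∫ _, c n ∂E.vectorMeasure ψ :=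
          integral_mono ((hA n) ψ).1.norm (integrable_const _) (hf n)
      _ = _ := by simp
  have h1 := hasSum_integral_of_summable_integral_norm (fun n => ((hA n) ψ).1) hsum
  refine ⟨?_, ?_⟩
  · refine Integrable.of_bound (C := ∑' n, c n) ?_ ?_
    · refine aestronglyMeasurable_of_tendsto_ae Filter.atTop
        (f := fun n x => ∑ i ∈ Finset.range n, f i x) (fun n => ?_) ?_
      · exact Finset.aestronglyMeasurable_fun_sum _ fun i _ => ((hA i) ψ).1.aestronglyMeasurable
      · exact .of_forall fun x =>
          (Summable.of_norm_bounded hc fun n => hf n x).hasSum.tendsto_sum_nat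
    · exact .of_forall fun x => tsum_of_norm_bounded hc.hasSum fun n => hf n x
  · have h2 : HasSum (fun n => inner ℂ ψ (A n ψ)) (inner ℂ ψ (B ψ)) :=
      (((innerSL ℂ ψ).comp (ContinuousLinearMap.apply ℂ H ψ)).hasSum hB)
    simp only [fun n => ((hA n) ψ).2] at h2
    exact h2.unique h1

/-- Every projection-valued measure with values in `M` on a standard Borel space has a measurable
embedding into the line whose integral is an operator of `M`. -/
theorem exists_measurableEmbedding_isIntegral [StandardBorelSpace X]
    (E : ProjectionValuedMeasure X H) (M : VonNeumannAlgebra H)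
    (hE : ∀ s, MeasurableSet s → E.proj s ∈ M) :
    ∃ g : X → ℝ, MeasurableEmbedding g ∧ ∃ A ∈ M, E.IsIntegral (fun x => (g x : ℂ)) A := by
  let b := MeasurableSpace.mapNatBool X
  have hb : Measurable b := MeasurableSpace.measurable_mapNatBool X
  -- Any ratio in `(0, 1/2)` works; at `1/2` distinct binary sequences can have the same sum.
  let c : ℝ := 1 / 3
  let g : X → ℝ := fun x => Cardinal.cantorFunction c (b x)
  let t : ℕ → Set X := fun n => {x | b x n = true}
  have ht : ∀ n, MeasurableSet (t n) := fun n =>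
    ((measurable_pi_apply n).comp hb) (measurableSet_singleton true)
  have hcs : Summable fun n => c ^ n :=
    summable_geometric_of_lt_one (by norm_num [c]) (by norm_num [c])
  have hterm : ∀ n x, Cardinal.cantorFunctionAux c (b x) n = (t n).indicator (fun _ => c ^ n) x := by
    intro n x
    by_cases h : b x n = true
    · rw [Cardinal.cantorFunctionAux_true h, Set.indicator_of_mem (show x ∈ t n from h)]
    · rw [Cardinal.cantorFunctionAux_false (by simpa using h),
        Set.indicator_of_notMem (show x ∉ t n from h)]
  have hgm : Measurable g := by
    refine measurable_of_tendsto_metrizable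
      (f := fun n x => ∑ i ∈ Finset.range n, (t i).indicator (fun _ => c ^ i) x)
      (fun n => Finset.measurable_fun_sum _ fun i _ => measurable_const.indicator (ht i))
      (tendsto_pi_nhds.2 fun x => ?_)
    simp only [← hterm]
    exact (Cardinal.summable_cantor_function (b x) (by norm_num [c])
      (by norm_num [c])).hasSum.tendsto_sum_nat
  have hgi : Function.Injective g :=
    (Cardinal.cantorFunction_injective (by norm_num [c]) (by norm_num [c])).comp
      (MeasurableSpace.injective_mapNatBool X)
  have hsum : Summable fun n => ((c ^ n : ℝ) : ℂ) • E.proj (t n) := by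
    refine Summable.of_norm_bounded hcs fun n => ?_
    rw [norm_smul, Complex.norm_real, Real.norm_of_nonneg (by positivity)]
    exact mul_le_of_le_one_right (by positivity)
      (IsStarProjection.norm_le _ (E.isStarProjection _ (ht n)))
  -- Lusin–Souslin: an injective Borel map on a standard Borel space sends Borel sets to Borel sets.
  refine ⟨g, hgm.measurableEmbedding hgi, ∑' n, ((c ^ n : ℝ) : ℂ) • E.proj (t n), ?_, ?_⟩
  · rw [← VonNeumannAlgebra.commutant_commutant M, VonNeumannAlgebra.mem_commutant_iff]
    intro y hy
    exact Commute.tsum_right y fun n =>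
      (Commute.smul_right (VonNeumannAlgebra.mem_commutant_iff.1 hy _ (hE _ (ht n))).symm _)
  · have h := IsIntegral.hasSum (fun n => (IsIntegral.proj E (ht n)).smul ((c ^ n : ℝ) : ℂ)) hcs
      (fun n x => by by_cases hx : x ∈ t n <;> simp [hx, c]) hsum.hasSum
    convert h using 2 with x
    change ((∑' n, Cardinal.cantorFunctionAux c (b x) n : ℝ) : ℂ) = _
    rw [Complex.ofReal_tsum]
    refine tsum_congr fun n => ?_
    rw [hterm]
    by_cases hx : x ∈ t n <;> simp [hx]

/-- The projection-valued measure on the line of a projection `P`, with mass `P` at `1` and `1 - P`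
at `0`. -/
noncomputable def ofProjection (P : H →L[ℂ] H) (hP : IsStarProjection P) :
    ProjectionValuedMeasure ℝ H where
  proj s := s.indicator (fun _ => P) 1 + s.indicator (fun _ => 1 - P) 0
  isStarProjection s _ := by
    by_cases h1 : (1 : ℝ) ∈ s <;> by_cases h0 : (0 : ℝ) ∈ s <;>
      simp [h0, h1, hP, hP.one_sub, IsStarProjection.zero, IsStarProjection.one]
  proj_univ := by simp
  hasSum_iUnion s _ hd φ ψ := by
    have key : ∀ (a : ℝ) (Q : H →L[ℂ] H),
        HasSum (fun n => inner ℂ φ ((s n).indicator (fun _ => Q) a ψ))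
          (inner ℂ φ ((⋃ n, s n).indicator (fun _ => Q) a ψ)) := by
      intro a Q
      by_cases h : a ∈ ⋃ n, s n
      · obtain ⟨k, hk⟩ := Set.mem_iUnion.1 h
        rw [Set.indicator_of_mem h]
        convert hasSum_single k fun n hn => ?_ using 1
        · rw [Set.indicator_of_mem hk]
        · rw [Set.indicator_of_notMem (Set.disjoint_left.1 (hd hn.symm) hk)]
          simp
      · have h' : ∀ n, a ∉ s n := fun n hn => h (Set.mem_iUnion_of_mem n hn)
        simp [h, h', hasSum_zero]
    simpa only [add_apply, inner_add_right] using (key 1 P).add (key 0 (1 - P))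

/-- Off the null set `{0, 1}ᶜ` the identity function is the indicator of `{1}`, which integrates to
`P`. -/
theorem isIntegral_ofProjection {P : H →L[ℂ] H} (hP : IsStarProjection P) :
    (ofProjection P hP).IsIntegral (fun t => (t : ℂ)) P := by
  set E := ofProjection P hP
  have h01 : E.proj {0, 1}ᶜ = 0 := by simp [E, ofProjection]
  have hE : E.proj {1} = P := by simp [E, ofProjection]
  intro ψ
  have h := IsIntegral.proj E (measurableSet_singleton (1 : ℝ)) ψ
  rw [hE] at h
  have hae : (({1} : Set ℝ).indicator fun _ => (1 : ℂ)) =ᵐ[E.vectorMeasure ψ]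
      fun t => (t : ℂ) := by
    have hnull : E.vectorMeasure ψ {0, 1}ᶜ = 0 := by
      rw [E.vectorMeasure_apply ψ (by measurability), h01]
      simp
    filter_upwards [compl_mem_ae_iff.2 hnull] with t ht
    rw [compl_compl] at ht
    rcases ht with rfl | rfl <;> simp
  exact ⟨h.1.congr hae, h.2.trans (integral_congr_ae hae)⟩

end ProjectionValuedMeasure

/-! ### Decompositions and the projection lattice -/

namespace VonNeumannAlgebra

variable {H : Type*} [NormedAddCommGroup H] [InnerProductSpace ℂ H] [CompleteSpace H]

theorem normalDecompositions_eq_selfAdjointDecompositions (M : VonNeumannAlgebra H) :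
    M.normalDecompositions = M.selfAdjointDecompositions := by
  ext 𝓑
  constructor
  · rintro ⟨N, hNM, -, E, hE, rfl⟩
    obtain ⟨g, hg, A, hAM, hA⟩ := E.exists_measurableEmbedding_isIntegral M
      fun s hs => E.proj_mem_of_isIntegral_id M hE hNM hs
    exact ⟨A, hAM, hA.isSelfAdjoint, E.map g hg.measurable,
      (E.isIntegral_map_iff hg.measurable Complex.measurable_ofReal).2 hA, E.projections_map hg⟩
  · rintro ⟨A, hAM, hA, E, hE, rfl⟩
    have he : MeasurableEmbedding ((↑) : ℝ → ℂ) :=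
      Complex.measurable_ofReal.measurableEmbedding Complex.ofReal_injective
    exact ⟨A, hAM, hA.isStarNormal, E.map _ he.measurable,
      (E.isIntegral_map_iff he.measurable measurable_id).2 hE, E.projections_map he⟩

theorem mem_normalProjections_iff {M : VonNeumannAlgebra H} {P : H →L[ℂ] H} :
    P ∈ M.normalProjections ↔ IsStarProjection P ∧ P ∈ M := by
  constructor
  · rintro ⟨_, ⟨N, hNM, -, E, hE, rfl⟩, s, hs, rfl⟩
    exact ⟨E.isStarProjection s hs, E.proj_mem_of_isIntegral_id M hE hNM hs⟩
  · rintro ⟨hP, hPM⟩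
    rw [normalProjections, normalDecompositions_eq_selfAdjointDecompositions]
    refine ⟨_, ⟨P, hPM, hP.isSelfAdjoint, .ofProjection P hP,
      ProjectionValuedMeasure.isIntegral_ofProjection hP, rfl⟩, {1}, measurableSet_singleton 1, ?_⟩
    simp [ProjectionValuedMeasure.ofProjection]

/-- Reduces meets and joins to closed subspaces invariant under the commutant, a class stable under
intersection and closed span. -/
theorem exists_projection_range_eq (M : VonNeumannAlgebra H) {U : Submodule ℂ H}
    (hU : IsClosed (U : Set H))
    (hinv : ∀ y ∈ M.commutant, U ∈ Module.End.invtSubmodule (y : H →ₗ[ℂ] H)) :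
    ∃ R ∈ M.normalProjections, R.range = U := by
  have : CompleteSpace U := hU.completeSpace_coe
  have hP : IsStarProjection U.starProjection := isStarProjection_starProjection
  have hr : U.starProjection.range = U := Submodule.range_starProjection U
  refine ⟨U.starProjection, mem_normalProjections_iff.2 ⟨hP, ?_⟩, hr⟩
  rw [IsStarProjection.mem_iff hP, hr]
  exact hinv

theorem isProjectionLattice_normalProjections (M : VonNeumannAlgebra H) :
    IsProjectionLattice M.normalProjections where
  isStarProjection P hP := (mem_normalProjections_iff.1 hP).1
  zero_mem := mem_normalProjections_iff.2 ⟨.zero _, zero_mem M⟩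
  one_mem := mem_normalProjections_iff.2 ⟨.one _, one_mem M⟩
  exists_inf P hP Q hQ := by
    obtain ⟨hP, hPM⟩ := mem_normalProjections_iff.1 hP
    obtain ⟨hQ, hQM⟩ := mem_normalProjections_iff.1 hQ
    refine M.exists_projection_range_eq
      ((ContinuousLinearMap.IsIdempotentElem.isClosed_range hP.isIdempotentElem).inter
        (ContinuousLinearMap.IsIdempotentElem.isClosed_range hQ.isIdempotentElem)) fun y hy => ?_
    exact Module.End.invtSubmodule.inf_mem
      ((IsStarProjection.mem_iff hP M).1 hPM y hy) ((IsStarProjection.mem_iff hQ M).1 hQM y hy)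
  exists_sup P hP Q hQ := by
    obtain ⟨hP, hPM⟩ := mem_normalProjections_iff.1 hP
    obtain ⟨hQ, hQM⟩ := mem_normalProjections_iff.1 hQ
    refine M.exists_projection_range_eq (Submodule.isClosed_topologicalClosure _) fun y hy => ?_
    have h := Module.End.invtSubmodule.sup_mem
      ((IsStarProjection.mem_iff hP M).1 hPM y hy) ((IsStarProjection.mem_iff hQ M).1 hQM y hy)
    rw [Module.End.mem_invtSubmodule_iff_map_le] at h ⊢
    exact (Submodule.topologicalClosure_map y _).trans (Submodule.topologicalClosure_mono h)

end VonNeumannAlgebra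

theorem proposition1 {H : Type*} [NormedAddCommGroup H] [InnerProductSpace ℂ H]
    [CompleteSpace H] [TopologicalSpace.SeparableSpace H] (M : VonNeumannAlgebra H) :
    M.normalProjections = M.selfAdjointProjections ∧
      IsProjectionLattice M.normalProjections ∧
      M.normalDecompositions = M.selfAdjointDecompositions := by
  have h := M.normalDecompositions_eq_selfAdjointDecompositions
  exact ⟨congrArg Set.sUnion h, M.isProjectionLattice_normalProjections, h⟩
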